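/- **Arrow algebras.** An arrow algebra $\mathcal A=(A,\le,\to,S)$ is a complete meet-semilattice $(A,\le)$ with a binary operation $\to$, antitone in the first and monotone in the second variable, and a subset $S\subseteq A$ that is upward closed, closed under modus ponens (if $a\to b\in S$ and $a\in S$ then $b\in S$) and contains the elements (with $\to$ associating to the right) $$\bigwedge_{a,b} a\to b\to a,\qquad \bigwedge_{a,b,c}(a\to b\to c)\to(a\to b)\to(a\to c),$$ $$\bigwedge_{a,(b_i)_{i\in I},(c_i)_{i\in I}}\Big(\bigwedge_{i} (a\to b_i\to c_i)\Big)\to a\to\bigwedge_{i}(b_i\to c_i).$$ A *nucleus* on $\mathcal A$ is a function $j:A\to A$ which is monotone for $\le$ and satisfies $\bigwedge_{a}(a\to ja)\in S$ and $\bigwedge_{a,b}\big((a\to jb)\to ja\to jb\big)\in S$. **Triposes.** A Heyting prealgebra is a preorder whose poset reflection is a Heyting algebra; we write $\simeq$ for isomorphism in a preorder. A *tripos* is a pseudofunctor $P$ from $\mathrm{Set}^{op}$ to Heyting prealgebras such that every $P(f)$ has, as a monotone map, a left and a right adjoint satisfying the Beck–Chevalley condition, and such that there is a generic element. The *arrow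 tripos* $P_{\mathcal A}$ sends a set $I$ to the set $A^I$ of functions $I\to A$, preordered by $\phi\vdash_I\psi\iff\bigwedge_{i\in I}(\phi(i)\to\psi(i))\in S$, and sends a function to precomposition with it. A *transformation* $\Phi:P\to Q$ of triposes is a family of monotone maps $\Phi_I:P(I)\to Q(I)$ that is natural up to isomorphism; transformations are preordered pointwise, and $\Phi$ is *cartesian* if every $\Phi_I$ preserves finite meets up to isomorphism. A *closure transformation* on $P$ is a cartesian transformation $\Phi:P\to P$ with $\mathrm{id}_P\le\Phi$ and $\Phi\Phi\simeq\Phi$; these form the preorder $\mathrm{ClTrans}(P)$. A *geometric morphism* $\Phi:Q\to P$ is a pair of transformations $\Phi^+:P\to Q$, $\Phi_+:Q\to P$ with $\Phi^+$ cartesian and $(\Phi^+)_I\dashv(\Phi_+)_I$ for every set $I$; it is an *inclusion* if every $(\Phi_+)_I$ reflects the order. $\mathrm{SubTrip}(P)$ is the preorder of triposes $Q$ endowed with a geometric inclusion $\Phi:Q\hookrightarrow P$, where $(\Phi:Q\hookrightarrow P)\subseteq(\Psi:R\hookrightarrow P)$ iff there is a geometric morphism $\Theta:Q\to R$ with $\Phi_+\simeq\Psi_+\circ\Theta_+$.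 **Proposition.** Let $\mathcal A=(A,\le,\to,S)$ be an arrow algebra and let $\mathrm N(\mathcal A)$ be the set of nuclei on $\mathcal A$, with the preorder induced by $P_{\mathcal A}(A)$, i.e. $j\le j'$ iff $\bigwedge_{a\in A}(ja\to j'a)\in S$. Then: 1. There is an equivalence of preorder categories $\mathrm{ClTrans}(P_{\mathcal A})\simeq \mathrm N(\mathcal A)$, which sends a closure transformation $\Phi$ to a nucleus isomorphic, in $P_{\mathcal A}(A)$, to $\Phi_A(\mathrm{id}_A)$, and whose inverse sends a nucleus $j$ to the closure transformation $\phi\mapsto j\circ\phi$. 2. Consequently, there is an equivalence of preorder categories $\mathrm{SubTrip}(P_{\mathcal A})\simeq \mathrm N(\mathcal A)^{op}$, which sends a geometric inclusion $\Phi:Q\hookrightarrow P_{\mathcal A}$ to a nucleus isomorphic, in $P_{\mathcal A}(A)$, to $(\Phi_+)_A(\Phi^+)_A(\mathrm{id}_A)$. -/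

import Mathlib

universe u

/-! ## Arrow algebras -/

/-- An arrow structure on a complete lattice (the same thing as a complete meet-semilattice):
a binary operation `imp`, antitone in the first and monotone in the second variable. -/
structure ArrowStructure (A : Type u) [CompleteLattice A] where
  imp : A → A → A
  imp_mono : ∀ {a a' b b' : A}, a' ≤ a → b ≤ b' → imp a b ≤ imp a' b'

namespace ArrowStructure

variable {A : Type u} [CompleteLattice A] (𝒜 : ArrowStructure A)

/-- The combinator `k`, the meet of all `a → b → a`. -/
def combK : A := ⨅ (a : A) (b : A), 𝒜.imp a (𝒜.imp b a)

/-- The combinator `s`, the meet of all `(a → b → c) → (a → b) → (a → c)`. -/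
def combS : A := ⨅ (a : A) (b : A) (c : A),
  𝒜.imp (𝒜.imp a (𝒜.imp b c)) (𝒜.imp (𝒜.imp a b) (𝒜.imp a c))

/-- The combinator `a`, the meet of all `(⨅ i, a → b i → c i) → a → ⨅ i, (b i → c i)`, over all
elements `a` and all families `b`, `c` indexed by a set. -/
def combA : A := sInf {x : A | ∃ (a : A) (I : Type u) (b c : I → A),
  x = 𝒜.imp (⨅ i, 𝒜.imp a (𝒜.imp (b i) (c i))) (𝒜.imp a (⨅ i, 𝒜.imp (b i) (c i)))}

end ArrowStructure

/-- An arrow algebra: an arrow structure together with a separator `sep`. -/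
structure ArrowAlgebra (A : Type u) [CompleteLattice A] extends ArrowStructure A where
  sep : Set A
  sep_upward : ∀ {a b : A}, a ∈ sep → a ≤ b → b ∈ sep
  sep_mp : ∀ {a b : A}, imp a b ∈ sep → a ∈ sep → b ∈ sep
  combK_mem : toArrowStructure.combK ∈ sep
  combS_mem : toArrowStructure.combS ∈ sep
  combA_mem : toArrowStructure.combA ∈ sep

/-! ## Triposes over the category of sets -/

/-- `c` is a Heyting implication from `a` to `b`. -/
def IsHeytingImp {α : Type u} [Preorder α] (a b c : α) : Prop :=
  ∀ x, x ≤ c ↔ ∀ y, y ≤ x → y ≤ a → y ≤ b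

/-- A Heyting prealgebra: a preorder with finite meets, finite joins and implications (all of them
unique up to isomorphism), i.e. a preorder whose poset reflection is a Heyting algebra. -/
structure IsHeytingPrealgebra (α : Type u) [Preorder α] : Prop where
  exists_top : ∃ t : α, IsTop t
  exists_bot : ∃ t : α, IsBot t
  exists_inf : ∀ a b : α, ∃ m, IsGLB {a, b} m
  exists_sup : ∀ a b : α, ∃ m, IsLUB {a, b} m
  exists_imp : ∀ a b : α, ∃ c, IsHeytingImp a b c

/-- Preservation of finite meets (the top element and binary meets) up to isomorphism. -/
structure PreservesFiniteMeets {α β : Type u} [Preorder α] [Preorder β] (f : α → β) : Prop where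
  map_top : ∀ t, IsTop t → IsTop (f t)
  map_inf : ∀ a b m, IsGLB {a, b} m → IsGLB {f a, f b} (f m)

/-- Morphisms of Heyting prealgebras. -/
structure IsHeytingMorphism {α β : Type u} [Preorder α] [Preorder β] (f : α → β) : Prop
    extends PreservesFiniteMeets f where
  monotone : Monotone f
  map_bot : ∀ t, IsBot t → IsBot (f t)
  map_sup : ∀ a b m, IsLUB {a, b} m → IsLUB {f a, f b} (f m)
  map_imp : ∀ a b c, IsHeytingImp a b c → IsHeytingImp (f a) (f b) (f c)

/-- A tripos over the category of sets: a pseudofunctor `P` from `Setᵒᵖ` to Heyting prealgebras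
such that each `P.map f` has a left and a right adjoint, with the Beck-Chevalley condition, and
such that there is a generic element. `AntisymmRel (· ≤ ·)` is isomorphism in a preorder. -/
structure Tripos where
  obj : Type u → Type u
  [pre : ∀ X, Preorder (obj X)]
  map : ∀ {X Y : Type u}, (X → Y) → obj Y → obj X
  heyting_obj : ∀ X, IsHeytingPrealgebra (obj X)
  heyting_map : ∀ {X Y : Type u} (f : X → Y), IsHeytingMorphism (map f)
  map_id : ∀ (X : Type u) (φ : obj X), AntisymmRel (· ≤ ·) (map (id : X → X) φ) φ
  map_comp : ∀ {X Y Z : Type u} (f : X → Y) (g : Y → Z) (φ : obj Z),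
    AntisymmRel (· ≤ ·) (map (g ∘ f) φ) (map f (map g φ))
  exists_left : ∀ {X Y : Type u} (f : X → Y), ∃ E : obj X → obj Y, GaloisConnection E (map f)
  exists_right : ∀ {X Y : Type u} (f : X → Y), ∃ R : obj X → obj Y, GaloisConnection (map f) R
  /-- For every pullback square `h ∘ f = k ∘ g` of sets, `∀_g ∘ f^*` and `k^* ∘ ∀_h` are
  isomorphic. -/
  beck_chevalley : ∀ {X Y Z W : Type u} (f : X → Y) (g : X → Z) (h : Y → W) (k : Z → W),
    (∀ x, h (f x) = k (g x)) → (∀ y z, h y = k z → ∃! x, f x = y ∧ g x = z) →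
    ∀ (Rg : obj X → obj Z) (Rh : obj Y → obj W),
      GaloisConnection (map g) Rg → GaloisConnection (map h) Rh →
      ∀ φ : obj Y, AntisymmRel (· ≤ ·) (Rg (map f φ)) (map k (Rh φ))
  exists_generic : ∃ (S : Type u) (σ : obj S), ∀ (X : Type u) (φ : obj X),
    ∃ f : X → S, AntisymmRel (· ≤ ·) φ (map f σ)

attribute [instance] Tripos.pre

namespace Tripos

/-- Transformations of triposes: pseudonatural families of monotone maps. -/
structure Transformation (P Q : Tripos.{u}) where
  app : ∀ X : Type u, P.obj X → Q.obj X
  monotone : ∀ X, Monotone (app X)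
  natural : ∀ {X Y : Type u} (f : X → Y) (φ : P.obj Y),
    AntisymmRel (· ≤ ·) (app X (P.map f φ)) (Q.map f (app Y φ))

/-- Transformations are ordered pointwise. -/
instance (P Q : Tripos.{u}) : Preorder (Transformation P Q) where
  le Φ Ψ := ∀ X φ, Φ.app X φ ≤ Ψ.app X φ
  le_refl _ _ _ := le_rfl
  le_trans _ _ _ h h' X φ := (h X φ).trans (h' X φ)

namespace Transformation

/-- The identity transformation. -/
def id (P : Tripos.{u}) : Transformation P P where
  app _ φ := φ
  monotone _ _ _ h := h
  natural _ _ := AntisymmRel.refl _ _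

/-- The composite `Ψ ∘ Φ`. -/
def comp {P Q R : Tripos.{u}} (Ψ : Transformation Q R) (Φ : Transformation P Q) :
    Transformation P R where
  app X φ := Ψ.app X (Φ.app X φ)
  monotone X _ _ h := Ψ.monotone X (Φ.monotone X h)
  natural {X Y} f φ :=
    AntisymmRel.trans
      ⟨Ψ.monotone X (Φ.natural f φ).1, Ψ.monotone X (Φ.natural f φ).2⟩
      (Ψ.natural f (Φ.app Y φ))

/-- Cartesian transformations preserve finite meets at each set. -/
def IsCartesian {P Q : Tripos.{u}} (Φ : Transformation P Q) : Prop :=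
  ∀ X, PreservesFiniteMeets (Φ.app X)

end Transformation

/-- A geometric morphism `Q → P`. -/
structure GeometricMorphism (Q P : Tripos.{u}) where
  inverseImage : Transformation P Q
  directImage : Transformation Q P
  adj : ∀ X, GaloisConnection (inverseImage.app X) (directImage.app X)
  cartesian : inverseImage.IsCartesian

namespace GeometricMorphism

/-- The identity geometric morphism. -/
def id (P : Tripos.{u}) : GeometricMorphism P P where
  inverseImage := Transformation.id P
  directImage := Transformation.id P
  adj _ _ _ := Iff.rfl
  cartesian _ := ⟨fun _ h => h, fun _ _ _ h => h⟩

/-- The composite `Ψ ∘ Φ` of geometric morphisms. -/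
def comp {P Q R : Tripos.{u}} (Ψ : GeometricMorphism Q R) (Φ : GeometricMorphism P Q) :
    GeometricMorphism P R where
  inverseImage := Φ.inverseImage.comp Ψ.inverseImage
  directImage := Ψ.directImage.comp Φ.directImage
  adj X _ _ := (Φ.adj X _ _).trans (Ψ.adj X _ _)
  cartesian X := ⟨fun t h => (Φ.cartesian X).map_top _ ((Ψ.cartesian X).map_top t h),
    fun a b m h => (Φ.cartesian X).map_inf _ _ _ ((Ψ.cartesian X).map_inf a b m h)⟩

/-- A geometric inclusion is one whose direct image reflects the order. -/
def IsInclusion {Q P : Tripos.{u}} (Φ : GeometricMorphism Q P) : Prop :=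
  ∀ (X : Type u) (φ ψ : Q.obj X), Φ.directImage.app X φ ≤ Φ.directImage.app X ψ → φ ≤ ψ

end GeometricMorphism

/-- Subtriposes of `P`: triposes endowed with a geometric inclusion into `P`. -/
structure SubTrip (P : Tripos.{u}) where
  dom : Tripos.{u}
  incl : GeometricMorphism dom P
  isInclusion : incl.IsInclusion

/-- `Φ ⊆ Ψ` when `Φ` is isomorphic to `Ψ ∘ Θ` (i.e. the direct images are isomorphic) for some
geometric morphism `Θ`. -/
instance (P : Tripos.{u}) : Preorder (SubTrip P) where
  le Φ Ψ := ∃ Θ : GeometricMorphism Φ.dom Ψ.dom,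
    AntisymmRel (· ≤ ·) Φ.incl.directImage (Ψ.incl.comp Θ).directImage
  le_refl Φ := ⟨GeometricMorphism.id _, fun _ _ => le_rfl, fun _ _ => le_rfl⟩
  le_trans := by
    rintro Φ Ψ Ξ ⟨Θ, h⟩ ⟨Θ', h'⟩
    exact ⟨Θ'.comp Θ, fun X φ => (h.1 X φ).trans (h'.1 X _),
      fun X φ => (h'.2 X _).trans (h.2 X φ)⟩

/-- Closure transformations on `P`: cartesian, inflationary and idempotent transformations. -/
structure ClTrans (P : Tripos.{u}) extends Transformation P P where
  cartesian : toTransformation.IsCartesian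
  inflationary : Transformation.id P ≤ toTransformation
  idempotent : AntisymmRel (· ≤ ·) (toTransformation.comp toTransformation) toTransformation

/-- Closure transformations are ordered as transformations. -/
instance (P : Tripos.{u}) : Preorder (ClTrans P) := Preorder.lift ClTrans.toTransformation

end Tripos

/-! ## The arrow tripos -/

namespace ArrowAlgebra

variable {A : Type u} [CompleteLattice A] (𝒜 : ArrowAlgebra A)

section Reasoning

local infixr:60 " ⇒ " => ArrowStructure.imp (ArrowAlgebra.toArrowStructure 𝒜)

variable {𝒜} {I : Type u} {w x y z t : I → A}

theorem mem_of_forall {c : A} (hc : c ∈ 𝒜.sep) (h : ∀ i, c ≤ x i) : ⨅ i, x i ∈ 𝒜.sep :=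
  𝒜.sep_upward hc (le_iInf h)

theorem mem_mono (h : ⨅ i, x i ∈ 𝒜.sep) (h' : ∀ i, x i ≤ y i) : ⨅ i, y i ∈ 𝒜.sep :=
  𝒜.sep_upward h (iInf_mono h')

theorem mem_comp {J : Type u} (f : J → I) (h : ⨅ i, x i ∈ 𝒜.sep) : ⨅ j, x (f j) ∈ 𝒜.sep :=
  𝒜.sep_upward h (le_iInf fun j => iInf_le x (f j))

theorem combA_le (a : A) {J : Type u} (b c : J → A) :
    𝒜.combA ≤ (⨅ j, a ⇒ b j ⇒ c j) ⇒ a ⇒ ⨅ j, (b j ⇒ c j) :=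
  sInf_le ⟨a, J, b, c, rfl⟩

theorem mp_fam (h : ⨅ i, (x i ⇒ y i ⇒ z i) ∈ 𝒜.sep) (hx : ⨅ i, x i ∈ 𝒜.sep) :
    ⨅ i, (y i ⇒ z i) ∈ 𝒜.sep := by
  have h1 : ⨅ i, ((⨅ i, x i) ⇒ y i ⇒ z i) ∈ 𝒜.sep :=
    mem_mono h fun i => 𝒜.imp_mono (iInf_le x i) le_rfl
  exact 𝒜.sep_mp (𝒜.sep_mp (𝒜.sep_upward 𝒜.combA_mem (combA_le _ y z)) h1) hx

theorem k_fam (x y : I → A) : ⨅ i, (x i ⇒ y i ⇒ x i) ∈ 𝒜.sep :=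
  mem_of_forall 𝒜.combK_mem fun i => (iInf_le _ (x i)).trans (iInf_le _ (y i))

theorem s_fam (x y z : I → A) :
    ⨅ i, ((x i ⇒ y i ⇒ z i) ⇒ (x i ⇒ y i) ⇒ x i ⇒ z i) ∈ 𝒜.sep :=
  mem_of_forall 𝒜.combS_mem fun i => (iInf_le _ (x i)).trans ((iInf_le _ (y i)).trans (iInf_le _ (z i)))

theorem weaken (x : I → A) (h : ⨅ i, (y i ⇒ z i) ∈ 𝒜.sep) :
    ⨅ i, (x i ⇒ y i ⇒ z i) ∈ 𝒜.sep :=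
  mp_fam (k_fam (fun i => y i ⇒ z i) x) h

theorem app_fam (h : ⨅ i, (x i ⇒ y i ⇒ z i) ∈ 𝒜.sep) (h' : ⨅ i, (x i ⇒ y i) ∈ 𝒜.sep) :
    ⨅ i, (x i ⇒ z i) ∈ 𝒜.sep :=
  mp_fam (mp_fam (s_fam x y z) h) h'

theorem refl_fam (x : I → A) : ⨅ i, (x i ⇒ x i) ∈ 𝒜.sep :=
  app_fam (k_fam x (fun i => x i ⇒ x i)) (k_fam x x)

theorem trans_fam (h : ⨅ i, (x i ⇒ y i) ∈ 𝒜.sep) (h' : ⨅ i, (y i ⇒ z i) ∈ 𝒜.sep) :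
    ⨅ i, (x i ⇒ z i) ∈ 𝒜.sep :=
  app_fam (weaken x h') h

theorem le_fam (h : ∀ i, x i ≤ y i) : ⨅ i, (x i ⇒ y i) ∈ 𝒜.sep :=
  mem_mono (refl_fam x) fun i => 𝒜.imp_mono le_rfl (h i)

theorem app_fam₂ (h : ⨅ i, (w i ⇒ x i ⇒ y i ⇒ z i) ∈ 𝒜.sep)
    (h' : ⨅ i, (w i ⇒ x i ⇒ y i) ∈ 𝒜.sep) : ⨅ i, (w i ⇒ x i ⇒ z i) ∈ 𝒜.sep :=
  app_fam (trans_fam h (s_fam x y z)) h'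

theorem trans_fam₂ (h : ⨅ i, (w i ⇒ x i ⇒ y i) ∈ 𝒜.sep) (h' : ⨅ i, (y i ⇒ z i) ∈ 𝒜.sep) :
    ⨅ i, (w i ⇒ x i ⇒ z i) ∈ 𝒜.sep :=
  app_fam₂ (weaken w (weaken x h')) h

theorem discharge (h : ⨅ i, (w i ⇒ (x i ⇒ y i) ⇒ z i) ∈ 𝒜.sep)
    (h' : ⨅ i, (x i ⇒ y i) ∈ 𝒜.sep) : ⨅ i, (w i ⇒ z i) ∈ 𝒜.sep :=
  app_fam h (weaken w h')

theorem eval_fam (x y : I → A) : ⨅ i, (x i ⇒ (x i ⇒ y i) ⇒ y i) ∈ 𝒜.sep :=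
  app_fam₂ (weaken x (refl_fam _)) (k_fam x _)

theorem to_delta (x : I → A) : ⨅ i, (x i ⇒ ⊤ ⇒ x i) ∈ 𝒜.sep := k_fam x fun _ => ⊤

theorem of_delta (x : I → A) : ⨅ i, ((⊤ ⇒ x i) ⇒ x i) ∈ 𝒜.sep :=
  app_fam (y := fun _ => ⊤) (refl_fam _) (le_fam fun _ => le_top)

theorem gen_fam {J : I → Type u} {y z : ∀ i, J i → A}
    (h : ⨅ p : Σ i, J i, (x p.1 ⇒ y p.1 p.2 ⇒ z p.1 p.2) ∈ 𝒜.sep) :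
    ⨅ i, (x i ⇒ ⨅ j, (y i j ⇒ z i j)) ∈ 𝒜.sep := by
  refine mp_fam (x := fun i => ⨅ j, (x i ⇒ y i j ⇒ z i j)) ?_ ?_
  · exact mem_of_forall 𝒜.combA_mem fun i => combA_le _ _ _
  · exact 𝒜.sep_upward h (le_iInf₂ fun i j => iInf_le _ (⟨i, j⟩ : Σ i, J i))

theorem gen_fam₂ {J : I → Type u} {y z : ∀ i, J i → A}
    (h : ⨅ p : Σ i, J i, (w p.1 ⇒ x p.1 ⇒ y p.1 p.2 ⇒ z p.1 p.2) ∈ 𝒜.sep) :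
    ⨅ i, (w i ⇒ x i ⇒ ⨅ j, (y i j ⇒ z i j)) ∈ 𝒜.sep :=
  trans_fam (gen_fam (y := fun i _ => x i) (z := fun i j => y i j ⇒ z i j) h)
    (mem_of_forall 𝒜.combA_mem fun _ => combA_le _ _ _)

variable (𝒜)

/-- A binary meet for the logical order. -/
def conj (a b : A) : A := ⨅ c, ((a ⇒ b ⇒ ⊤ ⇒ c) ⇒ ⊤ ⇒ c)

/-- A binary join for the logical order. -/
def disj (a b : A) : A := ⨅ c, ((a ⇒ ⊤ ⇒ c) ⇒ (b ⇒ ⊤ ⇒ c) ⇒ ⊤ ⇒ c)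

variable {𝒜}

theorem conj_intro (x y : I → A) : ⨅ i, (x i ⇒ y i ⇒ 𝒜.conj (x i) (y i)) ∈ 𝒜.sep := by
  refine gen_fam₂ (J := fun _ => A) ?_
  have e1 := eval_fam (𝒜 := 𝒜) (fun p : Σ _ : I, A => x p.1) (fun p => y p.1 ⇒ ⊤ ⇒ p.2)
  have e2 := eval_fam (𝒜 := 𝒜) (fun p : Σ _ : I, A => y p.1) (fun p => ⊤ ⇒ p.2)
  have b : ⨅ p : Σ _ : I, A, (((y p.1 ⇒ ⊤ ⇒ p.2) ⇒ ⊤ ⇒ p.2) ⇒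
      (x p.1 ⇒ y p.1 ⇒ ⊤ ⇒ p.2) ⇒ ((y p.1 ⇒ ⊤ ⇒ p.2) ⇒ ⊤ ⇒ p.2)) ∈ 𝒜.sep := k_fam _ _
  have g1 : ⨅ p : Σ _ : I, A, (x p.1 ⇒ y p.1 ⇒ (x p.1 ⇒ y p.1 ⇒ ⊤ ⇒ p.2) ⇒
      (y p.1 ⇒ ⊤ ⇒ p.2)) ∈ 𝒜.sep := trans_fam e1 (k_fam _ _)
  have g2 : ⨅ p : Σ _ : I, A, (y p.1 ⇒ (x p.1 ⇒ y p.1 ⇒ ⊤ ⇒ p.2) ⇒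
      ((y p.1 ⇒ ⊤ ⇒ p.2) ⇒ ⊤ ⇒ p.2)) ∈ 𝒜.sep := trans_fam e2 b
  have g3 : ⨅ p : Σ _ : I, A, (y p.1 ⇒ ((x p.1 ⇒ y p.1 ⇒ ⊤ ⇒ p.2) ⇒ (y p.1 ⇒ ⊤ ⇒ p.2)) ⇒
      ((x p.1 ⇒ y p.1 ⇒ ⊤ ⇒ p.2) ⇒ ⊤ ⇒ p.2)) ∈ 𝒜.sep := trans_fam g2 (s_fam _ _ _)
  exact app_fam₂ (weaken _ g3) g1

theorem conj_left (x y : I → A) : ⨅ i, (𝒜.conj (x i) (y i) ⇒ x i) ∈ 𝒜.sep := by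
  refine trans_fam (y := fun i => ⊤ ⇒ x i) (discharge
    (le_fam fun i => (iInf_le _ (x i) : 𝒜.conj (x i) (y i) ≤ _)) ?_) (of_delta x)
  exact trans_fam (to_delta x) (k_fam _ y)

theorem conj_right (x y : I → A) : ⨅ i, (𝒜.conj (x i) (y i) ⇒ y i) ∈ 𝒜.sep := by
  refine trans_fam (y := fun i => ⊤ ⇒ y i) (discharge
    (le_fam fun i => (iInf_le _ (y i) : 𝒜.conj (x i) (y i) ≤ _)) ?_) (of_delta y)
  exact weaken x (to_delta y)

theorem disj_left (x y : I → A) : ⨅ i, (x i ⇒ 𝒜.disj (x i) (y i)) ∈ 𝒜.sep :=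
  gen_fam (J := fun _ => A) (trans_fam₂ (eval_fam _ _) (k_fam _ _))

theorem disj_right (x y : I → A) : ⨅ i, (y i ⇒ 𝒜.disj (x i) (y i)) ∈ 𝒜.sep :=
  gen_fam (J := fun _ => A) (trans_fam (eval_fam _ _) (k_fam _ _))

theorem disj_elim (hx : ⨅ i, (x i ⇒ z i) ∈ 𝒜.sep) (hy : ⨅ i, (y i ⇒ z i) ∈ 𝒜.sep) :
    ⨅ i, (𝒜.disj (x i) (y i) ⇒ z i) ∈ 𝒜.sep := by
  refine trans_fam (y := fun i => ⊤ ⇒ z i) (discharge (discharge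
    (le_fam fun i => (iInf_le _ (z i) : 𝒜.disj (x i) (y i) ≤ _)) ?_) ?_) (of_delta z)
  · exact trans_fam hx (to_delta z)
  · exact trans_fam hy (to_delta z)

end Reasoning

/-- Predicates on a set `I`: the underlying set of `P_𝒜(I)`. -/
def Pred (_ : ArrowAlgebra A) (I : Type u) : Type u := I → A

/-- The logical order: `φ ⊢ ψ` iff the meet of all `φ i → ψ i` lies in the separator. -/
instance (I : Type u) : Preorder (𝒜.Pred I) where
  le φ ψ := ⨅ i, 𝒜.imp (φ i) (ψ i) ∈ 𝒜.sep
  le_refl φ := refl_fam φ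
  le_trans _ _ _ h h' := trans_fam h h'

/-- Reindexing of predicates along `f`: precomposition. -/
def reindex {X Y : Type u} (f : X → Y) (φ : 𝒜.Pred Y) : 𝒜.Pred X := fun x => φ (f x)

section TriposProof

variable {𝒜} {X Y : Type u}

theorem isGLB_conj (a b : 𝒜.Pred X) :
    IsGLB {a, b} (fun x => 𝒜.conj (a x) (b x) : 𝒜.Pred X) := by
  constructor
  · rintro c (rfl | rfl)
    · exact conj_left _ _
    · exact conj_right _ _
  · intro c hc
    have ha : c ≤ a := hc (by simp)
    have hb : c ≤ b := hc (by simp)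
    exact app_fam (trans_fam ha (conj_intro a b)) hb

theorem isLUB_disj (a b : 𝒜.Pred X) :
    IsLUB {a, b} (fun x => 𝒜.disj (a x) (b x) : 𝒜.Pred X) := by
  constructor
  · rintro c (rfl | rfl)
    · exact disj_left _ _
    · exact disj_right _ _
  · intro c hc
    exact disj_elim (hc (by simp : a ∈ ({a, b} : Set (𝒜.Pred X)))) (hc (by simp))

theorem isHeytingImp_imp (a b : 𝒜.Pred X) :
    IsHeytingImp a b (fun x => 𝒜.imp (a x) (b x) : 𝒜.Pred X) := by
  intro c
  constructor
  · intro h y hy ha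
    exact app_fam (trans_fam hy h) ha
  · intro h
    exact trans_fam₂ (conj_intro c a)
      (h (fun x => 𝒜.conj (c x) (a x)) (conj_left _ _) (conj_right _ _))

theorem heyting_pred (X : Type u) : IsHeytingPrealgebra (𝒜.Pred X) where
  exists_top := ⟨fun _ => ⊤, fun _ => le_fam fun _ => le_top⟩
  exists_bot := ⟨fun _ => ⊥, fun _ => le_fam fun _ => bot_le⟩
  exists_inf a b := ⟨_, isGLB_conj a b⟩
  exists_sup a b := ⟨_, isLUB_disj a b⟩
  exists_imp a b := ⟨_, isHeytingImp_imp a b⟩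

variable (𝒜)

/-- Universal quantification along `f`. -/
def forallAlong (f : X → Y) (α : 𝒜.Pred X) : 𝒜.Pred Y :=
  fun y => ⨅ j : {x // f x = y}, 𝒜.imp ⊤ (α j)

/-- Existential quantification along `f`. -/
def existsAlong (f : X → Y) (α : 𝒜.Pred X) : 𝒜.Pred Y := fun y => ⨅ a : A,
  𝒜.imp (⨅ j : {x // f x = y}, 𝒜.imp (α j) (𝒜.imp ⊤ a)) (𝒜.imp ⊤ (𝒜.imp ⊤ a))

variable {𝒜}

theorem gc_forallAlong (f : X → Y) : GaloisConnection (𝒜.reindex f) (𝒜.forallAlong f) := by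
  intro β α
  constructor
  · intro h
    refine gen_fam (J := fun y => {x // f x = y}) ?_
    have h1 : ⨅ x, 𝒜.imp (β (f x)) (𝒜.imp ⊤ (α x)) ∈ 𝒜.sep := trans_fam h (to_delta α)
    refine 𝒜.sep_upward h1 (le_iInf ?_)
    rintro ⟨_, x, rfl⟩
    exact iInf_le _ x
  · intro h
    refine trans_fam (y := fun x => 𝒜.imp ⊤ (α x)) ?_ (of_delta α)
    refine mem_mono (mem_comp f h) fun x => 𝒜.imp_mono le_rfl ?_
    exact iInf_le (fun j : {x' // f x' = f x} => 𝒜.imp ⊤ (α j)) ⟨x, rfl⟩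

theorem gc_existsAlong (f : X → Y) : GaloisConnection (𝒜.existsAlong f) (𝒜.reindex f) := by
  intro α β
  constructor
  · intro h
    refine trans_fam (y := fun x => 𝒜.existsAlong f α (f x)) ?_ (mem_comp f h)
    refine gen_fam (J := fun _ => A) ?_
    refine trans_fam₂ (y := fun p : Σ _ : X, A => 𝒜.imp ⊤ p.2) ?_ (to_delta _)
    refine mem_mono (eval_fam (fun p : Σ _ : X, A => α p.1) (fun p => 𝒜.imp ⊤ p.2)) ?_
    rintro ⟨x, a⟩
    refine 𝒜.imp_mono le_rfl (𝒜.imp_mono ?_ le_rfl)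
    exact iInf_le (fun j : {x' // f x' = f x} => 𝒜.imp (α j) (𝒜.imp ⊤ a)) ⟨x, rfl⟩
  · intro h
    have h1 : ⨅ x, 𝒜.imp (α x) (𝒜.imp ⊤ (β (f x))) ∈ 𝒜.sep := trans_fam h (to_delta _)
    have h2 : ⨅ y, (⨅ j : {x // f x = y}, 𝒜.imp (α j) (𝒜.imp ⊤ (β y))) ∈ 𝒜.sep := by
      refine 𝒜.sep_upward h1 (le_iInf₂ ?_)
      rintro _ ⟨x, rfl⟩
      exact iInf_le _ x
    have h3 := mp_fam (eval_fam _ (fun y => 𝒜.imp ⊤ (𝒜.imp ⊤ (β y)))) h2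
    refine trans_fam (trans_fam (trans_fam ?_ h3) (of_delta _)) (of_delta _)
    exact le_fam fun y => iInf_le _ (β y)

theorem IsHeytingImp.congr {α : Type u} [Preorder α] {a b c c' : α} (h : IsHeytingImp a b c)
    (h' : IsHeytingImp a b c') : AntisymmRel (· ≤ ·) c c' :=
  ⟨(h' c).2 ((h c).1 le_rfl), (h c').2 ((h' c').1 le_rfl)⟩

theorem heyting_reindex (f : X → Y) : IsHeytingMorphism (𝒜.reindex f) where
  monotone := (gc_forallAlong f).monotone_l
  map_top t ht φ := (gc_existsAlong f).le_u (ht _)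
  map_bot t ht φ := (gc_forallAlong f).l_le (ht _)
  map_inf a b m h := by simpa [Set.image_pair] using (gc_existsAlong f).isGLB_u_image h
  map_sup a b m h := by simpa [Set.image_pair] using (gc_forallAlong f).isLUB_l_image h
  map_imp a b c h := by
    have e := IsHeytingImp.congr h (isHeytingImp_imp a b)
    have e1 : 𝒜.reindex f c ≤ 𝒜.reindex f _ := (gc_forallAlong f).monotone_l e.1
    have e2 : 𝒜.reindex f _ ≤ 𝒜.reindex f c := (gc_forallAlong f).monotone_l e.2
    have k := isHeytingImp_imp (𝒜.reindex f a) (𝒜.reindex f b)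
    exact fun x => ⟨fun hx => (k x).1 (hx.trans e1), fun hx => ((k x).2 hx).trans e2⟩

theorem beckChevalley_pred {Z W : Type u} (f : X → Y) (g : X → Z) (h : Y → W) (k : Z → W)
    (hc : ∀ x, h (f x) = k (g x)) (hp : ∀ y z, h y = k z → ∃! x, f x = y ∧ g x = z)
    (Rg : 𝒜.Pred X → 𝒜.Pred Z) (Rh : 𝒜.Pred Y → 𝒜.Pred W)
    (hg : GaloisConnection (𝒜.reindex g) Rg) (hh : GaloisConnection (𝒜.reindex h) Rh)
    (φ : 𝒜.Pred Y) :
    AntisymmRel (· ≤ ·) (Rg (𝒜.reindex f φ)) (𝒜.reindex k (Rh φ)) := by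
  have m := (gc_forallAlong (𝒜 := 𝒜) k).monotone_l
  have e : 𝒜.forallAlong g (𝒜.reindex f φ) = 𝒜.reindex k (𝒜.forallAlong h φ) := by
    funext z
    apply le_antisymm
    · refine le_iInf ?_
      rintro ⟨y, hy⟩
      obtain ⟨x, ⟨rfl, hx⟩, -⟩ := hp y z hy
      exact iInf_le (fun j : {x // g x = z} => 𝒜.imp ⊤ (φ (f j))) ⟨x, hx⟩
    · refine le_iInf ?_
      rintro ⟨x, rfl⟩
      exact iInf_le (fun j : {y // h y = k (g x)} => 𝒜.imp ⊤ (φ j)) ⟨f x, hc x⟩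
  constructor
  · have h1 : Rg (𝒜.reindex f φ) ≤ 𝒜.forallAlong g (𝒜.reindex f φ) :=
      (gc_forallAlong g).le_u (hg.l_u_le _)
    rw [e] at h1
    exact h1.trans (m (hh.le_u ((gc_forallAlong h).l_u_le φ)))
  · have h1 : 𝒜.reindex k (Rh φ) ≤ 𝒜.reindex k (𝒜.forallAlong h φ) :=
      m ((gc_forallAlong h).le_u (hh.l_u_le _))
    rw [← e] at h1
    exact h1.trans (hg.le_u ((gc_forallAlong g).l_u_le _))

end TriposProof

/-- The arrow tripos `P_𝒜`: `P_𝒜(I)` is the set of functions `I → A` with the logical order, and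
reindexing is precomposition. -/
def tripos : Tripos.{u} where
  obj := 𝒜.Pred
  map f φ := 𝒜.reindex f φ
  heyting_obj := heyting_pred
  heyting_map := heyting_reindex
  map_id _ _ := AntisymmRel.refl _ _
  map_comp _ _ _ := AntisymmRel.refl _ _
  exists_left f := ⟨_, gc_existsAlong f⟩
  exists_right f := ⟨_, gc_forallAlong f⟩
  beck_chevalley := beckChevalley_pred
  exists_generic := ⟨A, fun a => a, fun _ φ => ⟨φ, AntisymmRel.refl _ _⟩⟩

/-! ## Nuclei -/

/-- A nucleus on an arrow algebra. -/
structure Nucleus where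
  toFun : A → A
  mono : ∀ {a b : A}, a ≤ b → toFun a ≤ toFun b
  unit_mem : ⨅ a, 𝒜.imp a (toFun a) ∈ 𝒜.sep
  bind_mem : ⨅ (a : A) (b : A),
    𝒜.imp (𝒜.imp a (toFun b)) (𝒜.imp (toFun a) (toFun b)) ∈ 𝒜.sep

/-- The underlying function of a nucleus, as an element of `P_𝒜(A)`. -/
def Nucleus.toPred {𝒜 : ArrowAlgebra A} (j : 𝒜.Nucleus) : 𝒜.tripos.obj A :=
  (j.toFun : A → A)

/-- Nuclei are preordered as elements of `P_𝒜(A)`. -/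
instance : Preorder 𝒜.Nucleus := Preorder.lift Nucleus.toPred

/-- The generic element of `P_𝒜`: the identity of `A`. -/
def generic : 𝒜.tripos.obj A := (fun a => a : A → A)

/-- The element `j ∘ φ` of `P_𝒜(I)`, for `φ` in `P_𝒜(I)`. -/
def Nucleus.postcomp {𝒜 : ArrowAlgebra A} (j : 𝒜.Nucleus) {I : Type u} (φ : 𝒜.tripos.obj I) :
    𝒜.tripos.obj I :=
  (fun i => j.toFun ((φ : I → A) i) : I → A)

end ArrowAlgebra

/-! ## Equivalences of preorders -/

/-! Every predicate `φ : X → A` is the reindexing of the generic predicate along itself, so by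
naturality a transformation `Φ` is, up to isomorphism, postcomposition with `f = Φ_A(id)`. This `f`
respects the logical order but need not be monotone for `≤`; it is replaced by the isomorphic `a ↦ ⨅
b ≥ a, ⊤ → f b` (`monotonize_antisymmRel`). The bind law follows by applying `Φ`, which preserves
meets and is idempotent, to `(a → j b) ∧ a ⊢ j b`. Conversely the bind law, being internal, can be
used in a context, so `j` preserves binary meets.

For subtriposes, `Φ ↦ Φ₊Φ⁺` reverses and reflects the order (`closure_le_closure_iff`). Every
nucleus arises this way: the preorder `φ ⊢ j ψ` is the logical order of another arrow algebra on
`A`, with implication `a → j b` and separator `{a | j a ∈ S}`, so its tripos structure comes from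
the general construction. -/

/-- A map of preorders which preserves and reflects the order and has a right inverse up to
isomorphism is an equivalence of preorder categories. -/
def equivalenceOfLeIff {α β : Type*} [Preorder α] [Preorder β] (f : α → β) (g : β → α)
    (hf : ∀ a b, f a ≤ f b ↔ a ≤ b) (hfg : ∀ b, AntisymmRel (· ≤ ·) (f (g b)) b) :
    CategoryTheory.Equivalence α β where
  functor := Monotone.functor (f := f) fun a b h => (hf a b).2 h
  inverse := Monotone.functor (f := g) fun a b h =>
    (hf _ _).1 (((hfg a).1.trans h).trans (hfg b).2)
  unitIso := CategoryTheory.NatIso.ofComponents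
    (fun a => ⟨CategoryTheory.homOfLE ((hf _ _).1 (hfg (f a)).2),
      CategoryTheory.homOfLE ((hf _ _).1 (hfg (f a)).1), rfl, rfl⟩) fun _ => rfl
  counitIso := CategoryTheory.NatIso.ofComponents
    (fun b => ⟨CategoryTheory.homOfLE (hfg b).1, CategoryTheory.homOfLE (hfg b).2, rfl, rfl⟩)
    fun _ => rfl
  functor_unitIso_comp _ := rfl

/-! ## Closure transformations of geometric morphisms -/

namespace Tripos

theorem _root_.PreservesFiniteMeets.of_gc {α β : Type u} [Preorder α] [Preorder β] {l : α → β}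
    {r : β → α} (h : GaloisConnection l r) : PreservesFiniteMeets r where
  map_top _ ht _ := h.le_u (ht _)
  map_inf a b m hm := by simpa [Set.image_pair] using h.isGLB_u_image hm

theorem _root_.PreservesFiniteMeets.comp {α β γ : Type u} [Preorder α] [Preorder β] [Preorder γ]
    {g : β → γ} {f : α → β} (hg : PreservesFiniteMeets g) (hf : PreservesFiniteMeets f) :
    PreservesFiniteMeets fun a => g (f a) where
  map_top t ht := hg.map_top _ (hf.map_top t ht)
  map_inf a b m hm := hg.map_inf _ _ _ (hf.map_inf a b m hm)

namespace GeometricMorphism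

/-- The closure transformation `Φ₊ ∘ Φ⁺` of a geometric morphism `Φ`. -/
def closure {P Q : Tripos.{u}} (Φ : GeometricMorphism Q P) : P.ClTrans where
  toTransformation := Φ.directImage.comp Φ.inverseImage
  cartesian X := (PreservesFiniteMeets.of_gc (Φ.adj X)).comp (Φ.cartesian X)
  inflationary X φ := (Φ.adj X).le_u_l φ
  idempotent :=
    ⟨fun X φ => (Φ.adj X).monotone_u ((Φ.adj X).l_u_le (Φ.inverseImage.app X φ)),
      fun X φ => (Φ.adj X).le_u_l (Φ.directImage.app X (Φ.inverseImage.app X φ))⟩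

end GeometricMorphism

/-! ### Comparing subtriposes through their closures. -/

namespace SubTrip

variable {P : Tripos.{u}}

/-- If `Φ₊ ≃ Ψ₊Θ₊`, the unit gives `φ ≤ Φ₊Φ⁺φ ≤ Ψ₊Θ₊Φ⁺φ`. Transposing along `Ψ⁺ ⊣ Ψ₊` and applying
`Ψ₊` again bounds `Ψ₊Ψ⁺φ`. -/
theorem closure_le_closure {Φ Ψ : P.SubTrip} (h : Φ ≤ Ψ) : Ψ.incl.closure ≤ Φ.incl.closure := by
  obtain ⟨Θ, h₁, h₂⟩ := h
  intro X φ
  have e₁ := h₁ X (Φ.incl.inverseImage.app X φ)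
  have e₂ := h₂ X (Φ.incl.inverseImage.app X φ)
  have unit := (Φ.incl.adj X).le_u_l φ
  exact ((Ψ.incl.adj X).monotone_u ((Ψ.incl.adj X _ _).2 (unit.trans e₁))).trans e₂

/-- The factorization of an inclusion `Φ` through an inclusion `Ψ` with smaller closure. -/
def factor (Φ Ψ : P.SubTrip) (h : Ψ.incl.closure ≤ Φ.incl.closure) :
    GeometricMorphism Φ.dom Ψ.dom where
  inverseImage := Φ.incl.inverseImage.comp Ψ.incl.directImage
  directImage := Ψ.incl.inverseImage.comp Φ.incl.directImage
  adj X x y := by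
    have unit := (Ψ.incl.adj X).le_u_l (Φ.incl.directImage.app X y)
    have counit := (Φ.incl.adj X).monotone_u ((Φ.incl.adj X).l_u_le y)
    -- After transposition, `Ψ₊x ≤ Φ₊y` is compared with `x ≤ Ψ⁺Φ₊y`. One way, `Ψ₊` reflects `Ψ₊x ≤
    -- Ψ₊Ψ⁺Φ₊y`; the other way, `Ψ₊Ψ⁺Φ₊y ≤ Φ₊Φ⁺Φ₊y ≤ Φ₊y`.
    refine (Φ.incl.adj X _ _).trans ⟨fun hxy => Ψ.isInclusion X _ _ (hxy.trans unit), fun hxy => ?_⟩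
    exact ((Ψ.incl.adj X).monotone_u hxy).trans ((h X (Φ.incl.directImage.app X y)).trans counit)
  cartesian X := (Φ.incl.cartesian X).comp (PreservesFiniteMeets.of_gc (Ψ.incl.adj X))

theorem closure_le_closure_iff {Φ Ψ : P.SubTrip} :
    Ψ.incl.closure ≤ Φ.incl.closure ↔ Φ ≤ Ψ := by
  refine ⟨fun h => ⟨factor Φ Ψ h, fun X φ => ?_, fun X φ => ?_⟩, closure_le_closure⟩
  · exact (Ψ.incl.adj X).le_u_l _
  · exact (h X _).trans ((Φ.incl.adj X).monotone_u ((Φ.incl.adj X).l_u_le φ))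

end SubTrip

end Tripos

namespace ArrowAlgebra

variable {A : Type u} [CompleteLattice A] {𝒜 : ArrowAlgebra A}

local infixr:60 " ⇒ " => ArrowStructure.imp (ArrowAlgebra.toArrowStructure 𝒜)

section Reasoning

variable {I : Type u} {x y z : I → A}

theorem flip_fam (h : ⨅ i, (x i ⇒ y i ⇒ z i) ∈ 𝒜.sep) : ⨅ i, (y i ⇒ x i ⇒ z i) ∈ 𝒜.sep :=
  app_fam₂ (weaken y h) (k_fam y x)

theorem imp_fam (x : I → A) (h : ⨅ i, (y i ⇒ z i) ∈ 𝒜.sep) :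
    ⨅ i, ((x i ⇒ y i) ⇒ x i ⇒ z i) ∈ 𝒜.sep :=
  mp_fam (s_fam x y z) (weaken x h)

end Reasoning

/-! ## The closure transformation of a nucleus -/

namespace Nucleus

variable (j : 𝒜.Nucleus) {I : Type u} {x y z : I → A}

theorem unit_fam (x : I → A) : ⨅ i, (x i ⇒ j.toFun (x i)) ∈ 𝒜.sep :=
  mem_comp x j.unit_mem

theorem mem_sep {a : A} (h : a ∈ 𝒜.sep) : j.toFun a ∈ 𝒜.sep :=
  𝒜.sep_mp (𝒜.sep_upward j.unit_mem (iInf_le _ a)) h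

variable {j}

theorem bind_fam₂ (h : ⨅ i, (x i ⇒ y i ⇒ j.toFun (z i)) ∈ 𝒜.sep) :
    ⨅ i, (x i ⇒ j.toFun (y i) ⇒ j.toFun (z i)) ∈ 𝒜.sep :=
  trans_fam h (mem_of_forall j.bind_mem fun i => (iInf_le _ (y i)).trans (iInf_le _ (z i)))

theorem bind_fam (h : ⨅ i, (y i ⇒ j.toFun (z i)) ∈ 𝒜.sep) :
    ⨅ i, (j.toFun (y i) ⇒ j.toFun (z i)) ∈ 𝒜.sep :=
  mp_fam (mem_of_forall j.bind_mem fun i => (iInf_le _ (y i)).trans (iInf_le _ (z i))) h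

theorem map_fam (h : ⨅ i, (y i ⇒ z i) ∈ 𝒜.sep) :
    ⨅ i, (j.toFun (y i) ⇒ j.toFun (z i)) ∈ 𝒜.sep :=
  bind_fam (trans_fam h (j.unit_fam z))

/-- Bind is applied in one argument with the other as context, then the arguments are exchanged and
bind is applied again. -/
theorem map_fam₂ (h : ⨅ i, (x i ⇒ y i ⇒ z i) ∈ 𝒜.sep) :
    ⨅ i, (j.toFun (x i) ⇒ j.toFun (y i) ⇒ j.toFun (z i)) ∈ 𝒜.sep :=
  flip_fam (bind_fam₂ (flip_fam (bind_fam₂ (trans_fam₂ h (j.unit_fam z)))))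

variable (j)

theorem mul_fam (x : I → A) : ⨅ i, (j.toFun (j.toFun (x i)) ⇒ j.toFun (x i)) ∈ 𝒜.sep :=
  bind_fam (refl_fam _)

/-- An implication into a closed element is closed. -/
theorem imp_closed_fam (x y : I → A) :
    ⨅ i, (j.toFun (x i ⇒ j.toFun (y i)) ⇒ x i ⇒ j.toFun (y i)) ∈ 𝒜.sep :=
  flip_fam (bind_fam₂ (eval_fam x fun i => j.toFun (y i)))

theorem preservesFiniteMeets (X : Type u) :
    PreservesFiniteMeets fun φ : 𝒜.tripos.obj X => j.postcomp φ where
  map_top t ht φ := (ht φ).trans (j.unit_fam t)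
  map_inf a b m hm := by
    constructor
    · rintro c (rfl | rfl)
      · exact map_fam (hm.1 (Or.inl rfl))
      · exact map_fam (hm.1 (Or.inr rfl))
    · intro c hc
      have ha : c ≤ j.postcomp a := hc (Or.inl rfl)
      have hb : c ≤ j.postcomp b := hc (Or.inr rfl)
      have hle := hm.2 (isGLB_conj (𝒜 := 𝒜) a b).1
      -- `map_fam₂` lifts the pairing `a ⊢ b → m` to `j a ⊢ j b → j m`.
      exact app_fam (trans_fam ha (map_fam₂ (trans_fam₂ (conj_intro (𝒜 := 𝒜) a b) hle))) hb

/-- Postcomposition with a nucleus is a closure transformation. -/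
def closure : 𝒜.tripos.ClTrans where
  app _ φ := j.postcomp φ
  monotone _ _ _ h := map_fam h
  natural _ _ := AntisymmRel.refl _ _
  cartesian := j.preservesFiniteMeets
  inflationary _ φ := j.unit_fam φ
  idempotent := ⟨fun _ φ => j.mul_fam φ, fun _ φ => j.unit_fam (fun i => j.toFun (φ i))⟩

/-! ## The subtripos of a nucleus -/

/-- The arrow algebra with implication `a → j b`, whose predicates are those of `𝒜` with the
order `φ ⊢ j ψ`. -/
def arrowAlgebra : ArrowAlgebra A where
  imp a b := a ⇒ j.toFun b
  imp_mono ha hb := 𝒜.imp_mono ha (j.mono hb)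
  sep := {a | j.toFun a ∈ 𝒜.sep}
  sep_upward ha hab := 𝒜.sep_upward ha (j.mono hab)
  sep_mp {a b} hab ha := by
    -- Here `j (a → j b) ∈ S` gives `a → j b ∈ S`, hence `j a → j b ∈ S`. Single elements are
    -- treated as families over a point.
    have h := 𝒜.sep_mp (𝒜.sep_upward (j.imp_closed_fam (I := PUnit) (fun _ => a) fun _ => b)
      (iInf_le _ PUnit.unit)) hab
    have h' := bind_fam (I := PUnit) (y := fun _ => a) (z := fun _ => b)
      (𝒜.sep_upward h (le_iInf fun _ => le_rfl))
    exact 𝒜.sep_mp (𝒜.sep_upward h' (iInf_le _ PUnit.unit)) ha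
  combK_mem := by
    refine j.mem_sep ?_
    have h := trans_fam₂ (k_fam (𝒜 := 𝒜) (fun p : A × A => p.1) fun p => p.2)
      (j.unit_fam fun p : A × A => p.1)
    refine 𝒜.sep_upward (trans_fam h (j.unit_fam _)) ?_
    exact le_iInf₂ fun a b => iInf_le _ (a, b)
  combS_mem := by
    refine j.mem_sep ?_
    -- Closedness and bind give `j (b → j c) ⊢ j b → j c`. Under `a →` this feeds the combinator `s`
    -- of `𝒜`; the remaining occurrences of `j` are units.
    have h := trans_fam (imp_fam (fun p : A × A × A => p.1)
        (trans_fam (j.imp_closed_fam (fun p : A × A × A => p.2.1) fun p => p.2.2)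
          (bind_fam₂ (refl_fam _))))
      (s_fam (𝒜 := 𝒜) _ _ _)
    refine 𝒜.sep_upward (trans_fam (trans_fam₂ h (j.unit_fam _)) (j.unit_fam _)) ?_
    exact le_iInf fun a => le_iInf₂ fun b c => iInf_le _ (a, b, c)
  combA_mem := by
    refine j.mem_sep ?_
    rw [ArrowStructure.combA, sInf_eq_iInf']
    -- The index sets `I` range over a whole universe, too large to index a family. The meet is
    -- therefore indexed by its own elements, with parameters chosen for each.
    choose a J b c h using fun s : {x : A | ∃ (a : A) (I : Type u) (b c : I → A),
      x = (⨅ i, a ⇒ j.toFun (b i ⇒ j.toFun (c i))) ⇒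
        j.toFun (a ⇒ j.toFun (⨅ i, (b i ⇒ j.toFun (c i))))} => s.2
    refine mem_mono ?_ fun s => (h s).ge
    refine trans_fam (trans_fam₂ (gen_fam₂ ?_) (j.unit_fam _)) (j.unit_fam _)
    exact trans_fam (le_fam fun p : Σ s, J s => iInf_le _ p.2)
      (imp_fam _ (j.imp_closed_fam (fun p : Σ s, J s => b p.1 p.2) fun p => c p.1 p.2))

/-- The order of the new algebra says `j (⨅ i, φ i → j ψ i) ∈ S`. Monotonicity of `j` for `≤` moves
`j` inside the meet, where it is absorbed because implications into closed elements are closed. -/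
theorem arrowAlgebra_le_iff {X : Type u} (φ ψ : X → A) :
    LE.le (α := j.arrowAlgebra.tripos.obj X) φ ψ ↔
      ⨅ i, (φ i ⇒ j.toFun (ψ i)) ∈ 𝒜.sep := by
  refine ⟨fun h => ?_, fun h => j.mem_sep h⟩
  have h' : ⨅ i, j.toFun (φ i ⇒ j.toFun (ψ i)) ∈ 𝒜.sep :=
    𝒜.sep_upward h (le_iInf fun i => j.mono (iInf_le _ i))
  exact mp_fam (j.imp_closed_fam φ ψ) h'

/-- The geometric inclusion of the tripos of `j`-closed predicates. -/
def subTrip : 𝒜.tripos.SubTrip where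
  dom := j.arrowAlgebra.tripos
  incl :=
    { inverseImage :=
        { app := fun _ φ => φ
          monotone := fun _ _ ψ h =>
            (j.arrowAlgebra_le_iff _ _).2 (trans_fam h (j.unit_fam ψ))
          natural := fun _ _ => AntisymmRel.refl _ _ }
      directImage :=
        { app := fun _ φ => j.postcomp φ
          monotone := fun _ _ _ h => bind_fam ((j.arrowAlgebra_le_iff _ _).1 h)
          natural := fun _ _ => AntisymmRel.refl _ _ }
      adj := fun _ _ _ => j.arrowAlgebra_le_iff _ _
      cartesian := fun X =>
        { map_top := fun t ht φ =>
            (j.arrowAlgebra_le_iff _ _).2 (trans_fam (ht φ) (j.unit_fam t))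
          map_inf := fun a b m hm => by
            -- A lower bound of `a`, `b` in the new order is a logical lower bound of `j a`, `j b`,
            -- whose meet is `j m`.
            have hj := (j.preservesFiniteMeets X).map_inf a b m hm
            constructor
            · rintro c (rfl | rfl)
              · exact (j.arrowAlgebra_le_iff _ _).2
                  (trans_fam (hm.1 (Or.inl rfl)) (j.unit_fam _))
              · exact (j.arrowAlgebra_le_iff _ _).2
                  (trans_fam (hm.1 (Or.inr rfl)) (j.unit_fam _))
            · intro c hc
              refine (j.arrowAlgebra_le_iff _ _).2 (hj.2 ?_)
              rintro d (rfl | rfl)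
              · exact (j.arrowAlgebra_le_iff _ _).1 (hc (Or.inl rfl))
              · exact (j.arrowAlgebra_le_iff _ _).1 (hc (Or.inr rfl)) } }
  isInclusion _ φ ψ h :=
    (j.arrowAlgebra_le_iff _ _).2 (trans_fam (j.unit_fam φ) h)

end Nucleus

/-! ## The nucleus of a closure transformation -/

variable (𝒜) in
/-- The largest function `A → A` monotone for `≤` below `a ↦ ⊤ → f a`. -/
def monotonize (f : A → A) (a : A) : A := ⨅ b : {b // a ≤ b}, ⊤ ⇒ f b

end ArrowAlgebra

namespace Tripos.ClTrans

open ArrowAlgebra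

variable {A : Type u} [CompleteLattice A] {𝒜 : ArrowAlgebra A} (Φ : 𝒜.tripos.ClTrans)

local infixr:60 " ⇒ " => ArrowStructure.imp (ArrowAlgebra.toArrowStructure 𝒜)

/-- The value of a transformation at the generic predicate. -/
def genericValue : A → A := Φ.app A 𝒜.generic

theorem app_antisymmRel {X : Type u} (φ : 𝒜.tripos.obj X) :
    AntisymmRel (· ≤ ·) (Φ.app X φ) (𝒜.reindex φ Φ.genericValue : 𝒜.tripos.obj X) :=
  Φ.natural φ 𝒜.generic

/-- The prefix `⊤ →` is harmless up to isomorphism and makes each term of the meet an implication,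
as the combinator `a` requires for generalization. -/
theorem monotonize_antisymmRel :
    AntisymmRel (α := 𝒜.Pred A) (· ≤ ·) (𝒜.monotonize Φ.genericValue) Φ.genericValue := by
  constructor
  · refine trans_fam (y := fun a => ⊤ ⇒ Φ.genericValue a) (le_fam fun a => ?_) (of_delta _)
    exact iInf_le (fun b : {b // a ≤ b} => ⊤ ⇒ Φ.genericValue b) ⟨a, le_rfl⟩
  -- Over the set of pairs `a ≤ b` the first projection entails the second, so monotonicity of `Φ`
  -- over this set yields `f a → f b` uniformly.
  · let R := Σ a : A, {b // a ≤ b}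
    let φ : 𝒜.tripos.obj R := fun p : R => p.1
    let ψ : 𝒜.tripos.obj R := fun p : R => (p.2 : A)
    have h : φ ≤ ψ := le_fam fun p : R => p.2.2
    refine gen_fam (J := fun a => {b // a ≤ b}) (trans_fam ?_ (k_fam _ _))
    exact ((Φ.app_antisymmRel φ).2.trans (Φ.monotone R h)).trans (Φ.app_antisymmRel ψ).1

theorem app_antisymmRel_monotonize {X : Type u} (φ : 𝒜.tripos.obj X) :
    AntisymmRel (· ≤ ·) (Φ.app X φ)
      (𝒜.reindex φ (𝒜.monotonize Φ.genericValue) : 𝒜.tripos.obj X) :=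
  (Φ.app_antisymmRel φ).trans
    ⟨mem_comp (φ : X → A) Φ.monotonize_antisymmRel.2,
      mem_comp (φ : X → A) Φ.monotonize_antisymmRel.1⟩

/-- The nucleus of a closure transformation on an arrow tripos. -/
def nucleus : 𝒜.Nucleus where
  toFun := 𝒜.monotonize Φ.genericValue
  mono {a b} h := le_iInf fun c =>
    iInf_le (fun c : {c // a ≤ c} => ⊤ ⇒ Φ.genericValue c) ⟨c, h.trans c.2⟩
  unit_mem := (Φ.inflationary A 𝒜.generic).trans (Φ.app_antisymmRel_monotonize 𝒜.generic).1
  bind_mem := by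
    let j := 𝒜.monotonize Φ.genericValue
    let x : 𝒜.tripos.obj (A × A) := fun p : A × A => p.1
    let y : 𝒜.tripos.obj (A × A) := fun p : A × A => p.2
    let jy : 𝒜.tripos.obj (A × A) := fun p : A × A => j p.2
    let w : 𝒜.tripos.obj (A × A) := fun p : A × A => p.1 ⇒ j p.2
    let c : 𝒜.tripos.obj (A × A) := fun p : A × A => 𝒜.conj (p.1 ⇒ j p.2) p.1
    have hc : IsGLB {w, x} c := isGLB_conj (𝒜 := 𝒜) w x
    have hj := Φ.app_antisymmRel_monotonize y
    -- Modus ponens gives `w ∧ x ⊢ Φ y`; then monotonicity and idempotence give `Φ (w ∧ x) ⊢ Φ y`.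
    have hcy : c ≤ Φ.app _ y :=
      le_trans (b := jy) (app_fam (hc.1 (Or.inl rfl)) (hc.1 (Or.inr rfl))) hj.2
    have h : Φ.app _ c ≤ jy :=
      ((Φ.monotone _ hcy).trans (Φ.idempotent.1 _ y)).trans hj.1
    have hw : w ≤ Φ.app _ w := Φ.inflationary _ w
    have hmeet := (Φ.cartesian _).map_inf _ _ _ hc
    let d : 𝒜.tripos.obj (A × A) := fun p : A × A => 𝒜.conj (p.1 ⇒ j p.2) (j p.1)
    -- Since `Φ c` is a meet of `Φ w` and `Φ x`, inflation on the `w` side alone gives `w ∧ j x ⊢ Φ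
    -- c`; currying then yields the bind law.
    have hd : d ≤ Φ.app _ c := by
      refine hmeet.2 ?_
      rintro e (rfl | rfl)
      · exact le_trans (b := w) (conj_left _ _) hw
      · exact trans_fam (conj_right _ _) (Φ.app_antisymmRel_monotonize x).2
    refine 𝒜.sep_upward (trans_fam₂ (conj_intro _ _) (hd.trans h)) ?_
    exact le_iInf₂ fun a b => iInf_le _ (a, b)

theorem app_antisymmRel_postcomp {X : Type u} (φ : 𝒜.tripos.obj X) :
    AntisymmRel (· ≤ ·) (Φ.app X φ) (Φ.nucleus.postcomp φ) :=
  Φ.app_antisymmRel_monotonize φ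

theorem nucleus_toPred : AntisymmRel (· ≤ ·) Φ.nucleus.toPred (Φ.app A 𝒜.generic) :=
  Φ.monotonize_antisymmRel

theorem nucleus_le_nucleus_iff (Φ Ψ : 𝒜.tripos.ClTrans) :
    Φ.nucleus ≤ Ψ.nucleus ↔ Φ ≤ Ψ := by
  refine ⟨fun h X φ => ?_, fun h => ?_⟩
  · have h' : Φ.nucleus.postcomp φ ≤ Ψ.nucleus.postcomp φ := mem_comp (φ : X → A) h
    exact ((Φ.app_antisymmRel_postcomp φ).1.trans h').trans (Ψ.app_antisymmRel_postcomp φ).2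
  · exact (Φ.nucleus_toPred.1.trans (h A 𝒜.generic)).trans Ψ.nucleus_toPred.2

end Tripos.ClTrans

theorem proposition8p8 {A : Type u} [CompleteLattice A] (𝒜 : ArrowAlgebra A) :
    (∃ e : CategoryTheory.Equivalence 𝒜.tripos.ClTrans 𝒜.Nucleus,
      (∀ Φ : 𝒜.tripos.ClTrans,
        AntisymmRel (· ≤ ·) (e.functor.obj Φ).toPred (Φ.app A 𝒜.generic)) ∧
      (∀ (j : 𝒜.Nucleus) (I : Type u) (φ : 𝒜.tripos.obj I),
        (e.inverse.obj j).app I φ = j.postcomp φ)) ∧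
    (∃ e : CategoryTheory.Equivalence 𝒜.tripos.SubTrip (Opposite 𝒜.Nucleus),
      ∀ Φ : 𝒜.tripos.SubTrip,
        AntisymmRel (· ≤ ·) (e.functor.obj Φ).unop.toPred
          (Φ.incl.directImage.app A (Φ.incl.inverseImage.app A 𝒜.generic))) := by
  refine ⟨⟨equivalenceOfLeIff Tripos.ClTrans.nucleus ArrowAlgebra.Nucleus.closure
    Tripos.ClTrans.nucleus_le_nucleus_iff fun j => j.closure.nucleus_toPred,
    fun Φ => Φ.nucleus_toPred, fun _ _ _ => rfl⟩,
    ⟨(equivalenceOfLeIff (fun Φ : 𝒜.tripos.SubTrip => OrderDual.toDual Φ.incl.closure.nucleus)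
      (fun j => ArrowAlgebra.Nucleus.subTrip (OrderDual.ofDual j)) (fun Φ Ψ => ?_) fun j => ?_).trans
      (CategoryTheory.orderDualEquivalence 𝒜.Nucleus), fun Φ => Φ.incl.closure.nucleus_toPred⟩⟩
  · exact (Tripos.ClTrans.nucleus_le_nucleus_iff _ _).trans Tripos.SubTrip.closure_le_closure_iff
  -- The closure of `j.subTrip` is postcomposition with `j`, whose value at the generic predicate is
  -- `j`. The order dual swaps the two inequalities.
  · exact (ArrowAlgebra.Nucleus.subTrip (OrderDual.ofDual j)).incl.closure.nucleus_toPred.symm
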